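/- Let $M\ge 2$ and let $f_0,\dots,f_{M-1}$ be probability densities with respect to a common measure $\mu$ on a measurable space $\mathcal X$. Let $\mathbf P_m$ be the law with density $f_m$ of the raw observation $X$, and assume that $$0<\mathbf E_m\Big[\log\frac{f_m(X)}{f_{m'}(X)}\Big]<\infty\qquad\text{for all } m\ne m'$$ (the expectation being $+\infty$ if $\mathbf P_m\{f_{m'}(X)=0\}>0$). A deterministic quantizer with binary messages is a measurable map $\phi:\mathcal X\to\{0,1\}$; write $f_m(u;\phi)=\mathbf P_m\{\phi(X)=u\}$ and, with $0\log\frac00=0$, $$I(m,m';\phi)=\sum_{u\in\{0,1\}}f_m(u;\phi)\log\frac{f_m(u;\phi)}{f_{m'}(u;\phi)} .$$ A quantizer is a randomization $\bar\phi=\sum_j p^j\phi^j$ that assigns probability masses $p^j$ (with $\sum_j p^j=1$) to finitely or countably many deterministic quantizers $\phi^j$. Its divergences are $I(m,m';\bar\phi)=\sum_j p^jI(m,m';\phi^j)$, and $I(m;\bar\phi)=\min_{m'\neq m}I(m,m';\bar\phi)$. A maximin quantizer for the state $m$ is a quantizer that attains $\sup_{\bar\phi}I(m;\bar\phi)$,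 the supremum being over all quantizers. A deterministic quantizer $\phi$ is an unambiguous likelihood quantizer (ULQ) if there are real numbers $a_0,\dots,a_{M-1}$ such that $\phi(x)=1$ if $\sum_m a_mf_m(x)>0$ and $\phi(x)=0$ otherwise, and $$\mathbf P_{m'}\Big\{\sum_{m=0}^{M-1}a_mf_m(X)=0\Big\}=0\qquad\text{for every } m'. \tag{$*$}$$ The densities are called linearly independent if $(*)$ holds for all real $a_0,\dots,a_{M-1}$ that are not all zero. Then for each $m=0,\dots,M-1$ a maximin quantizer for the state $m$ exists and can be chosen as a randomization of at most $M-1$ deterministic quantizers. If moreover the densities $f_0,\dots,f_{M-1}$ are linearly independent, then for each $m$ a maximin quantizer can be chosen as a randomization of at most $M-1$ ULQs. -/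

import Mathlib

open MeasureTheory
open scoped ENNReal

namespace Quantizer

/-- The law `P_m` of the raw observation: density `f_m` with respect to the common measure `μ`. -/
noncomputable def law {X : Type*} [MeasurableSpace X] {M : ℕ} (μ : Measure X)
    (f : Fin M → X → ℝ) (m : Fin M) : Measure X :=
  μ.withDensity (fun x => ENNReal.ofReal (f m x))

/-- Deterministic quantizers with binary messages: measurable maps to `{0, 1}`. -/
abbrev Det (X : Type*) [MeasurableSpace X] : Type _ :=
  {φ : X → Fin 2 // Measurable φ}

/-- All quantizers, deterministic or randomized: probability masses on deterministic quantizers.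
A `PMF` has total mass one and therefore automatically has countable support; the deterministic
quantizers are the point masses. -/
abbrev Rand (X : Type*) [MeasurableSpace X] : Type _ :=
  PMF (Det X)

section

variable {X : Type*} [MeasurableSpace X] {M : ℕ} (μ : Measure X) (f : Fin M → X → ℝ)

/-- The induced mass function `f_m(u; φ) = P_m (φ(X) = u)`. -/
noncomputable def msgProb (m : Fin M) (φ : Det X) (u : Fin 2) : ℝ :=
  (law μ f m).real {x | φ.1 x = u}

/-- The K-L divergence `I(m, m'; φ)` of a deterministic quantizer, with `0 log (0 / 0) = 0`.
(When `P_m` is absolutely continuous with respect to `P_m'`, no term `a log (a / 0)` with `a > 0`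
occurs.) -/
noncomputable def detInfo (m m' : Fin M) (φ : Det X) : ℝ :=
  ∑ u : Fin 2, msgProb μ f m φ u * Real.log (msgProb μ f m φ u / msgProb μ f m' φ u)

/-- The K-L divergence `I(m, m'; φ̄) = ∑ p^j I(m, m'; φ^j)` of a randomized quantizer: the weighted
average of the divergences of the deterministic quantizers it randomizes. (When the divergence of
`P_m` from `P_m'` is finite, the summands `I(m, m'; φ^j)` lie between zero and that divergence, so
that the series converges.) -/
noncomputable def randInfo (m m' : Fin M) (φ : Rand X) : ℝ :=
  ∑' ψ : Det X, (φ ψ).toReal * detInfo μ f m m' ψ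

/-- `I(m; φ̄) = min_{m' ≠ m} I(m, m'; φ̄)`, a minimum over a finite set, nonempty when `M ≥ 2`. -/
noncomputable def minInfo (m : Fin M) (φ : Rand X) : ℝ :=
  ⨅ m' : {m' : Fin M // m' ≠ m}, randInfo μ f m m' φ

/-- `φ̄` is a maximin quantizer for the state `m`: it attains the supremum of `I(m; ·)` over all
quantizers, deterministic or randomized. -/
def IsMaximin (m : Fin M) (φ : Rand X) : Prop :=
  ∀ ψ : Rand X, minInfo μ f m ψ ≤ minInfo μ f m φ

/-- `φ̄` is a randomization of at most `n` deterministic quantizers. -/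
def RandomizesAtMost (φ : Rand X) (n : ℕ) : Prop :=
  φ.support.encard ≤ (n : ℕ∞)

/-- The condition that `∑ a_m f_m(X) = 0` has probability zero in every state. -/
def NoTie (a : Fin M → ℝ) : Prop :=
  ∀ m' : Fin M, law μ f m' {x | ∑ m, a m * f m x = 0} = 0

/-- Unambiguous likelihood quantizers: `φ(X) = I(∑ a_m f_m(X) > 0)` where the sum vanishes with
probability zero in every state. -/
def IsULQ (φ : Det X) : Prop :=
  ∃ a : Fin M → ℝ, (∀ x, φ.1 x = if 0 < ∑ m, a m * f m x then 1 else 0) ∧ NoTie μ f a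

/-- Linear independence of the densities, in the probabilistic sense: every nonzero linear
combination is nonzero with probability one in every state. -/
def DensLinIndep : Prop :=
  ∀ a : Fin M → ℝ, a ≠ 0 → NoTie μ f a

/-- The standing assumption `0 < E_m [log (f_m(X) / f_m'(X))] < ∞` for all `m ≠ m'`. The
expectation is the K-L divergence of the law `P_m` from `P_m'`; it is infinite when
`f_m'(X) = 0` has positive probability under `P_m`. -/
def KLAssumption : Prop :=
  ∀ m m' : Fin M, m ≠ m' →
    0 < InformationTheory.klDiv (law μ f m) (law μ f m') ∧
      InformationTheory.klDiv (law μ f m) (law μ f m') < ∞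

end

end Quantizer

/-! A binary quantizer enters the divergences only through the vector v of the probabilities P_k{φ =
1}, a point of the set W (`testRegion`) of expectation vectors of [0,1]-valued tests. W is convex
and, by weak-* compactness, compact. For fixed m the M - 1 payoffs `binaryKL (v m) (v m')` are
convex and continuous on W. Randomization convexifies the payoff vectors, so the least coordinate is
to be maximized over the compact convex hull of the image of W.

Separating this hull from the open orthant above the optimal value c gives weights β whose average
payoff is at most c on W; this bounds countable randomizations too. Since the payoffs are convex, an
optimal mixture can use only extreme points of W (`exists_maximin_mixture_extremePoints`). Its
payoff vectors lie on the hyperplane where the β-average equals c, so Carathéodory needs M - 1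
points instead of M.

Extreme points of W come from indicators, that is, from deterministic quantizers. For linearly
independent densities, a supporting functional at an extreme point supplies the coefficients of a
ULQ, by the Neyman–Pearson argument. -/

namespace Quantizer

/-! ### Convex geometry: separation, Carathéodory and maximin mixtures. -/

section Convex

open Finset

/-- In a finite-dimensional space the convex hull of a compact set is compact. -/
theorem isCompact_convexHull_of_finiteDimensional {E : Type*} [NormedAddCommGroup E]
    [NormedSpace ℝ E] [FiniteDimensional ℝ E] {s : Set E} (hs : IsCompact s) :
    IsCompact (convexHull ℝ s) := by
  classical
  rcases s.eq_empty_or_nonempty with rfl | ⟨x₀, hx₀⟩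
  · simp
  -- By Carathéodory, N points always suffice, so the hull is the continuous image of a simplex
  -- times a power of `s`; shorter combinations are padded by `x₀` with weight zero.
  let N := Module.finrank ℝ E + 1
  let Φ : (Fin N → ℝ) × (Fin N → E) → E := fun q => ∑ i, q.1 i • q.2 i
  have hΦ : Continuous Φ := by fun_prop
  have hK : IsCompact ((stdSimplex ℝ (Fin N)) ×ˢ (Set.univ.pi fun _ : Fin N => s)) :=
    (isCompact_stdSimplex ℝ (Fin N)).prod (isCompact_univ_pi fun _ => hs)
  convert hK.image hΦ using 1
  apply Set.Subset.antisymm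
  · intro x hx
    obtain ⟨ι, _, z, w, hz, hind, hw, hw1, rfl⟩ := eq_pos_convex_span_of_mem_convexHull hx
    have hcard : Fintype.card ι ≤ Fintype.card (Fin N) := by
      rw [Fintype.card_fin]
      exact hind.card_le_finrank_succ.trans
        (Nat.succ_le_succ (Submodule.finrank_le _))
    obtain ⟨e⟩ := Function.Embedding.nonempty_of_card_le hcard
    have hsum : ∀ (g : Fin N → E), (∀ i, g (e i) = z i) →
        ∑ j, (Function.extend e w 0) j • g j = ∑ i, w i • z i := by
      intro g hg
      rw [← Finset.sum_subset (Finset.subset_univ (univ.map e))]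
      · simp [Finset.sum_map, e.injective.extend_apply, hg]
      · intro j _ hj
        rw [Function.extend_apply', Pi.zero_apply, zero_smul]
        simpa using hj
    refine ⟨(Function.extend e w 0, Function.extend e z fun _ => x₀), ⟨⟨fun j => ?_, ?_⟩, ?_⟩, ?_⟩
    · by_cases hj : ∃ i, e i = j
      · obtain ⟨i, rfl⟩ := hj
        simpa [e.injective.extend_apply] using (hw i).le
      · simp [Function.extend_apply' _ _ _ hj]
    · rw [← hw1, ← Finset.sum_subset (Finset.subset_univ (univ.map e))]
      · simp [Finset.sum_map, e.injective.extend_apply]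
      · intro j _ hj
        refine (Function.extend_apply' _ _ _ ?_).trans rfl
        simpa using hj
    · intro j _
      by_cases hj : ∃ i, e i = j
      · obtain ⟨i, rfl⟩ := hj
        simpa [e.injective.extend_apply] using hz ⟨i, rfl⟩
      · simpa [Function.extend_apply' _ _ _ hj] using hx₀
    · exact hsum (Function.extend e z fun _ => x₀) fun i => e.injective.extend_apply _ _ _
  · rintro _ ⟨⟨w, z⟩, ⟨⟨hw0, hw1⟩, hz⟩, rfl⟩
    exact (convex_convexHull ℝ s).sum_mem (fun i _ => hw0 i) hw1
      fun i _ => subset_convexHull ℝ s (hz i trivial)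

/-- If a convex set of payoff vectors contains no vector all of whose coordinates exceed `c`, then
some averaging of the coordinates is at most `c` on it. -/
theorem exists_weights_sum_le {ι : Type*} [Fintype ι] {K : Set (ι → ℝ)}
    (hK : Convex ℝ K) (hne : K.Nonempty) {c : ℝ} (hc : ∀ y ∈ K, ∃ i, y i ≤ c) :
    ∃ β : ι → ℝ, (∀ i, 0 ≤ β i) ∧ ∑ i, β i = 1 ∧ ∀ y ∈ K, ∑ i, β i * y i ≤ c := by
  classical
  let O : Set (ι → ℝ) := Set.univ.pi fun _ => Set.Ioi c
  have hO : ∀ y, y ∈ O ↔ ∀ i, c < y i := fun y => by simp [O]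
  have hdisj : Disjoint O K := by
    rw [Set.disjoint_left]
    intro y hy hyK
    obtain ⟨i, hi⟩ := hc y hyK
    exact absurd ((hO y).1 hy i) (not_lt.2 hi)
  obtain ⟨g, u, hg1, hg2⟩ := geometric_hahn_banach_open
    (convex_pi fun _ _ => convex_Ioi c) (isOpen_set_pi Set.finite_univ fun _ _ => isOpen_Ioi)
    hK hdisj
  let b : ι → ℝ := fun i => -g (Pi.single i 1)
  have hgb : ∀ y, g y = -∑ i, b i * y i := by
    intro y
    conv_lhs => rw [pi_eq_sum_univ' y]
    simp [b, mul_comm]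
  have hb0 : ∀ i, 0 ≤ b i := by
    intro i
    by_contra! hneg
    -- The orthant is stable under increasing coordinate `i`; a negative `b i` would make `g`
    -- unbounded above on it.
    have key : ∀ t : ℝ, 0 ≤ t → g (fun _ => c + 1) - t * b i < u := by
      intro t ht
      have h := hg1 ((fun _ => c + 1) + t • Pi.single i 1) <| (hO _).2 fun j => by
        by_cases hj : j = i
        · subst hj; simp; linarith
        · simp [hj]
      rw [map_add, map_smul] at h
      simpa [b] using h
    have h := key ((|u| + |g (fun _ => c + 1)|) / (-b i)) (by
      apply div_nonneg (by positivity); linarith)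
    have e : (|u| + |g (fun _ => c + 1)|) / (-b i) * b i = -(|u| + |g (fun _ => c + 1)|) := by
      field_simp [hneg.ne]
    rw [e] at h
    linarith [le_abs_self u, neg_abs_le (g (fun _ => c + 1))]
  have hS : 0 < ∑ i, b i := by
    refine lt_of_le_of_ne (Finset.sum_nonneg fun i _ => hb0 i) fun h0 => ?_
    have hz : ∀ i, b i = 0 := fun i =>
      (Finset.sum_eq_zero_iff_of_nonneg fun i _ => hb0 i).1 h0.symm i (Finset.mem_univ i)
    obtain ⟨y, hy⟩ := hne
    have h1 := hg1 (fun _ => c + 1) ((hO _).2 fun _ => by simp)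
    have h2 := hg2 y hy
    simp [hgb, hz] at h1 h2
    linarith
  -- The corner of the orthant is only a limit point, hence the constant vectors slightly above `c`.
  have hcu : -u ≤ c * ∑ i, b i := by
    have : ∀ ε : ℝ, 0 < ε → -u ≤ c * ∑ i, b i + ε := by
      intro ε hε
      have h := hg1 (fun _ => c + ε / ∑ i, b i) ((hO _).2 fun _ => by
        have := div_pos hε hS; linarith)
      rw [hgb, ← Finset.sum_mul] at h
      have : (∑ i, b i) * (c + ε / ∑ i, b i) = c * ∑ i, b i + ε := by field_simp
      linarith
    exact le_of_forall_pos_le_add this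
  refine ⟨fun i => b i / ∑ j, b j, fun i => div_nonneg (hb0 i) hS.le, ?_, fun y hy => ?_⟩
  · rw [← Finset.sum_div, div_self hS.ne']
  · have h2 := hg2 y hy
    rw [hgb] at h2
    have : ∑ i, b i / (∑ j, b j) * y i = (∑ i, b i * y i) / ∑ j, b j := by
      rw [Finset.sum_div]; exact Finset.sum_congr rfl fun i _ => by ring
    rw [this, div_le_iff₀ hS]
    linarith

/-- Affinely independent points on a hyperplane of `ι → ℝ` are at most as many as the
dimension. -/
theorem card_le_of_affineIndependent_of_hyperplane {ι J : Type*} [Fintype ι] [Fintype J]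
    {z : J → ι → ℝ} (hz : AffineIndependent ℝ z) {β : ι → ℝ} (hβ : β ≠ 0) {c : ℝ}
    (hc : ∀ j, ∑ i, β i * z j i = c) : Fintype.card J ≤ Fintype.card ι := by
  classical
  rcases isEmpty_or_nonempty J with hJ | hJ
  · simp
  let L : (ι → ℝ) →ₗ[ℝ] ℝ := ∑ i, β i • LinearMap.proj i
  have hL : ∀ y, L y = ∑ i, β i * y i := fun y => by simp [L]
  have hlt : LinearMap.ker L < ⊤ := by
    rw [lt_top_iff_ne_top, Ne, LinearMap.ker_eq_top]
    rintro h0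
    apply hβ
    ext i
    have := hL (Pi.single i 1)
    simpa [h0, Pi.single_apply] using this.symm
  -- Differences of the points lie in a kernel of dimension at most `card ι - 1`; affine
  -- independence allows one more point than this dimension.
  have hle : vectorSpan ℝ (Set.range z) ≤ LinearMap.ker L := by
    rw [vectorSpan_def, Submodule.span_le]
    rintro _ ⟨_, ⟨i, rfl⟩, _, ⟨j, rfl⟩, rfl⟩
    simp [hL, hc, mul_sub, Finset.sum_sub_distrib]
  rw [← hz.finrank_vectorSpan_add_one]
  have h1 := Submodule.finrank_mono hle
  have h2 := Submodule.finrank_lt hlt.ne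
  simp at h2
  omega

/-- Maximin over mixtures of a convex vector payoff on a compact convex set: the mixture can be
taken on at most as many points as there are payoffs, all of them extreme. -/
theorem exists_maximin_mixture_extremePoints {κ ι : Type*} [Fintype κ] [Fintype ι] [Nonempty ι]
    {W : Set (κ → ℝ)} (hW : IsCompact W) (hne : W.Nonempty)
    {I : (κ → ℝ) → ι → ℝ} (hcont : ContinuousOn I W) (hconv : ∀ i, ConvexOn ℝ W fun v => I v i) :
    ∃ (c : ℝ) (β : ι → ℝ) (n : ℕ) (w : Fin n → ℝ) (v : Fin n → κ → ℝ),
      (∀ i, 0 ≤ β i) ∧ ∑ i, β i = 1 ∧ (∀ x ∈ W, ∑ i, β i * I x i ≤ c) ∧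
      n ≤ Fintype.card ι ∧ (∀ j, 0 < w j) ∧ ∑ j, w j = 1 ∧
      (∀ j, v j ∈ W.extremePoints ℝ) ∧ ∀ i, c ≤ ∑ j, w j * I (v j) i := by
  classical
  -- The strictly convex last coordinate breaks ties: among the optimal mixtures, one maximizing it
  -- can use only extreme points.
  let G : (κ → ℝ) → (ι → ℝ) × ℝ := fun v => (I v, ∑ k, v k ^ 2)
  let K := convexHull ℝ (G '' W)
  have hGc : ContinuousOn G W := hcont.prodMk (by fun_prop)
  have hK : IsCompact K := isCompact_convexHull_of_finiteDimensional (hW.image_of_continuousOn hGc)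
  have hKne : K.Nonempty := (hne.image G).convexHull
  let F : (ι → ℝ) × ℝ → ℝ := fun y => univ.inf' univ_nonempty fun i => y.1 i
  have hF : Continuous F := Continuous.finset_inf'_apply _ fun i _ => by fun_prop
  obtain ⟨y₀, hy₀, hmax⟩ := hK.exists_isMaxOn hKne hF.continuousOn
  set c := F y₀
  have hleF : ∀ y : (ι → ℝ) × ℝ, c ≤ F y ↔ ∀ i, c ≤ y.1 i := fun y => by simp [F, Finset.le_inf'_iff]
  let K1 := K ∩ {y | c ≤ F y}
  have hK1 : IsCompact K1 := hK.inter_right (isClosed_le continuous_const hF)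
  obtain ⟨y, ⟨hyK, hyc⟩, hymax⟩ := hK1.exists_isMaxOn ⟨y₀, hy₀, le_refl c⟩
    continuous_snd.continuousOn
  obtain ⟨β, hβ0, hβ1, hβ⟩ := exists_weights_sum_le (K := Prod.fst '' K) (c := c)
    ((convex_convexHull ℝ _).linear_image (LinearMap.fst ℝ (ι → ℝ) ℝ)) (hKne.image _) (by
      rintro _ ⟨x, hx, rfl⟩
      obtain ⟨i, -, hi⟩ := Finset.exists_mem_eq_inf' (univ_nonempty (α := ι)) fun i => x.1 i
      exact ⟨i, hi ▸ hmax hx⟩)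
  have hβW : ∀ x ∈ W, ∑ i, β i * I x i ≤ c := fun x hx =>
    hβ _ ⟨G x, subset_convexHull ℝ _ ⟨x, hx, rfl⟩, rfl⟩
  obtain ⟨J, _, z, w, hz, -, hw, hw1, hwz⟩ := eq_pos_convex_span_of_mem_convexHull hyK
  have hext : ∀ j, z j ∈ G '' (W.extremePoints ℝ) := by
    intro j
    obtain ⟨v, hv, hvz⟩ := hz ⟨j, rfl⟩
    refine ⟨v, mem_extremePoints_iff_left.2 ⟨hv, ?_⟩, hvz⟩
    rintro a ha b hb ⟨s, t, hs, ht, hst, hab⟩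
    -- Splitting `v` into `a` and `b` lowers no payoff, by convexity, and raises the last coordinate
    -- by a multiple of the squared distance of `a` and `b`; maximality of `y` forces `a = b`.
    let m := s • G a + t • G b
    have hm : m ∈ K := convex_convexHull ℝ _ (subset_convexHull ℝ _ (Set.mem_image_of_mem G ha))
      (subset_convexHull ℝ _ (Set.mem_image_of_mem G hb)) hs.le ht.le hst
    have hm1 : ∀ i, (z j).1 i ≤ m.1 i := fun i => by
      have := (hconv i).2 ha hb hs.le ht.le hst
      simpa [← hvz, G, m, hab] using this
    have hm2 : m.2 = (z j).2 + s * t * ∑ k, (a k - b k) ^ 2 := by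
      rw [← hvz, ← hab]
      simp only [G, m, Prod.snd_add, Prod.smul_snd, smul_eq_mul, Finset.mul_sum,
        ← Finset.sum_add_distrib, Pi.add_apply, Pi.smul_apply]
      refine Finset.sum_congr rfl fun k _ => ?_
      obtain rfl : t = 1 - s := by linarith
      ring
    let y' := ∑ i, w i • Function.update z j m i
    have hy' : y' = y + w j • (m - z j) := by
      have : ∀ i, w i • Function.update z j m i =
          w i • z i + (if i = j then w j • (m - z j) else 0) := by
        intro i
        by_cases h : i = j
        · subst h; simp [smul_sub]
        · simp [h]
      simp only [y', this, Finset.sum_add_distrib, hwz]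
      simp
    have hy'K : y' ∈ K := by
      refine (convex_convexHull ℝ _).sum_mem (fun i _ => (hw i).le) hw1 fun i _ => ?_
      by_cases h : i = j
      · subst h; simpa using hm
      · simpa [h] using subset_convexHull ℝ _ (hz ⟨i, rfl⟩)
    have hy'c : c ≤ F y' := (hleF _).2 fun i => by
      have h1 := (hleF y).1 hyc i
      have h2 := mul_nonneg (hw j).le (sub_nonneg.2 (hm1 i))
      rw [hy']
      simp only [Prod.fst_add, Prod.smul_fst, Prod.fst_sub, Pi.add_apply, Pi.smul_apply,
        Pi.sub_apply, smul_eq_mul]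
      linarith
    have h3 : y'.2 ≤ y.2 := hymax ⟨hy'K, hy'c⟩
    rw [hy'] at h3
    simp only [Prod.snd_add, Prod.smul_snd, Prod.snd_sub, smul_eq_mul, hm2] at h3
    have h4 : ∑ k, (a k - b k) ^ 2 ≤ 0 := by
      have hp : 0 < w j * (s * t) := mul_pos (hw j) (mul_pos hs ht)
      by_contra! hlt
      have := mul_pos hp hlt
      linarith
    have h5 : a = b := by
      ext k
      have := (Finset.sum_eq_zero_iff_of_nonneg fun k _ => sq_nonneg (a k - b k)).1
        (le_antisymm h4 (Finset.sum_nonneg fun k _ => sq_nonneg _)) k (mem_univ k)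
      exact sub_eq_zero.1 (pow_eq_zero_iff (two_ne_zero) |>.1 this)
    subst h5
    rw [← hab, ← add_smul, hst, one_smul]
  have hy1 : y.1 ∈ convexHull ℝ (I '' W.extremePoints ℝ) := by
    rw [← hwz, Prod.fst_sum]
    refine (convex_convexHull ℝ _).sum_mem (fun i _ => (hw i).le) hw1 fun i _ => ?_
    obtain ⟨v, hv, hvz⟩ := hext i
    exact subset_convexHull ℝ _ ⟨v, hv, by rw [← hvz]⟩
  -- Carathéodory is applied again, now without the tie-breaking coordinate, which would cost an
  -- extra point.
  obtain ⟨J', _, x, p, hx, hind, hp, hp1, hpx⟩ := eq_pos_convex_span_of_mem_convexHull hy1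
  have hyi : ∀ i, ∑ j, p j * x j i = y.1 i := fun i => by
    rw [← hpx]; simp
  have hxc : ∀ j, ∑ i, β i * x j i ≤ c := fun j => by
    obtain ⟨v, hv, hvx⟩ := hx ⟨j, rfl⟩
    rw [← hvx]; exact hβW v hv.1
  have htot : c ≤ ∑ j, p j * ∑ i, β i * x j i := by
    calc c = ∑ i, β i * c := by rw [← Finset.sum_mul, hβ1, one_mul]
      _ ≤ ∑ i, β i * y.1 i := Finset.sum_le_sum fun i _ =>
          mul_le_mul_of_nonneg_left ((hleF y).1 hyc i) (hβ0 i)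
      _ = _ := by
          simp_rw [← hyi, Finset.mul_sum]
          rw [Finset.sum_comm]
          exact Finset.sum_congr rfl fun _ _ => Finset.sum_congr rfl fun _ _ => by ring
  -- Each β-average is at most `c` while their mean with positive weights is at least `c`.
  have hxe : ∀ j, ∑ i, β i * x j i = c := by
    have h0 : ∑ j, p j * (c - ∑ i, β i * x j i) = 0 := by
      refine le_antisymm ?_ (Finset.sum_nonneg fun j _ =>
        mul_nonneg (hp j).le (sub_nonneg.2 (hxc j)))
      simp only [mul_sub, Finset.sum_sub_distrib, ← Finset.sum_mul, hp1]
      linarith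
    intro j
    have := (Finset.sum_eq_zero_iff_of_nonneg fun j _ =>
        mul_nonneg (hp j).le (sub_nonneg.2 (hxc j))).1 h0 j (mem_univ j)
    rcases mul_eq_zero.1 this with h | h
    · exact absurd h (hp j).ne'
    · linarith
  have hcard := card_le_of_affineIndependent_of_hyperplane hind (β := β) (by
    rintro rfl; simp at hβ1) hxe
  choose v hv hvx using fun j => hx ⟨j, rfl⟩
  let e := (Fintype.equivFin J').symm
  refine ⟨c, β, Fintype.card J', p ∘ e, v ∘ e, hβ0, hβ1, hβW, hcard, fun j => hp _, ?_,
    fun j => hv _, fun i => ?_⟩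
  · rw [← hp1]; exact e.sum_comp p
  · calc c ≤ y.1 i := (hleF y).1 hyc i
      _ = ∑ j, p j * I (v j) i := by simp_rw [← hyi, hvx]
      _ = _ := (e.sum_comp fun j => p j * I (v j) i).symm
      _ ≤ _ := le_rfl

end Convex
-- The region of test expectations: convexity, compactness, extreme points.
section Region

open Filter Topology

variable {X κ : Type*} [MeasurableSpace X]

/-- Randomized tests: measurable functions with values in `[0, 1]`. -/
def IsTest (h : X → ℝ) : Prop :=
  Measurable h ∧ ∀ x, h x ∈ Set.Icc (0 : ℝ) 1

theorem IsTest.integrable {h : X → ℝ} (hh : IsTest h) (P : Measure X) [IsFiniteMeasure P] :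
    Integrable h P :=
  Integrable.of_bound hh.1.aestronglyMeasurable 1 <| ae_of_all _ fun x => by
    rw [Real.norm_eq_abs, abs_of_nonneg (hh.2 x).1]; exact (hh.2 x).2

theorem IsTest.integrable_mul {h : X → ℝ} (hh : IsTest h) {P : Measure X} {q : X → ℝ}
    (hq : Integrable q P) : Integrable (fun x => h x * q x) P :=
  hq.bdd_mul hh.1.aestronglyMeasurable (c := 1) <| ae_of_all _ fun x => by
    rw [Real.norm_eq_abs, abs_of_nonneg (hh.2 x).1]; exact (hh.2 x).2

theorem IsTest.one_sub {h : X → ℝ} (hh : IsTest h) : IsTest fun x => 1 - h x :=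
  ⟨hh.1.const_sub 1, fun x => ⟨by linarith [(hh.2 x).2], by linarith [(hh.2 x).1]⟩⟩

theorem isTest_indicator {A : Set X} (hA : MeasurableSet A) : IsTest (A.indicator fun _ => (1 : ℝ)) :=
  ⟨measurable_const.indicator hA, fun x => by by_cases h : x ∈ A <;> simp [h]⟩

/-- The vectors of expectations of randomized tests under the laws `P m`. -/
def testRegion (P : κ → Measure X) : Set (κ → ℝ) :=
  {v | ∃ h : X → ℝ, IsTest h ∧ ∀ m, v m = ∫ x, h x ∂P m}

theorem zero_mem_testRegion (P : κ → Measure X) : (0 : κ → ℝ) ∈ testRegion P :=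
  ⟨0, ⟨measurable_const, fun x => by simp⟩, fun m => by simp⟩

theorem convex_testRegion (P : κ → Measure X) [∀ m, IsFiniteMeasure (P m)] :
    Convex ℝ (testRegion P) := by
  rintro v ⟨h, hh, hv⟩ v' ⟨h', hh', hv'⟩ s t hs ht hst
  refine ⟨fun x => s * h x + t * h' x, ⟨(hh.1.const_mul s).add (hh'.1.const_mul t), fun x => ?_⟩,
    fun m => ?_⟩
  · exact convex_Icc (0 : ℝ) 1 (hh.2 x) (hh'.2 x) hs ht hst
  · rw [integral_add ((hh.integrable _).const_mul s) ((hh'.integrable _).const_mul t),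
      integral_const_mul, integral_const_mul, ← hv, ← hv']
    rfl

/-- The region of test expectations is compact. -/
theorem isCompact_testRegion [Fintype κ] (P : κ → Measure X) [∀ m, IsFiniteMeasure (P m)] :
    IsCompact (testRegion P) := by
  -- Each `P m` has a density bounded by 1 with respect to this finite measure, so expectations
  -- become L² inner products, which are weak-* continuous in the test.
  let ν : Measure X := ∑ m, P m
  have hle : ∀ m, P m ≤ ν := fun m => Measure.le_iff.2 fun s _ => by
    simp only [ν, Measure.finsetSum_apply]
    exact Finset.single_le_sum (f := fun m => P m s) (fun _ _ => zero_le) (Finset.mem_univ m)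
  have hac : ∀ m, P m ≪ ν := fun m => (hle m).absolutelyContinuous
  let r : κ → X → ℝ := fun m x => ((P m).rnDeriv ν x).toReal
  have hrm : ∀ m, Measurable (r m) := fun m => (Measure.measurable_rnDeriv _ _).ennreal_toReal
  have hr2 : ∀ m, MemLp (r m) 2 ν := fun m =>
    MemLp.of_bound (hrm m).aestronglyMeasurable 1 <| by
      filter_upwards [Measure.rnDeriv_le_one_of_le (hle m)] with x hx
      rw [Real.norm_eq_abs, abs_of_nonneg ENNReal.toReal_nonneg]
      exact ENNReal.toReal_le_of_le_ofReal zero_le_one (by simpa using hx)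
  let g : κ → Lp ℝ 2 ν := fun m => (hr2 m).toLp (r m)
  let ind : ∀ A : {A : Set X // MeasurableSet A}, Lp ℝ 2 ν := fun A =>
    indicatorConstLp 2 A.2 (measure_ne_top ν A.1) (1 : ℝ)
  let R : ℝ := ν.real Set.univ ^ (ENNReal.toReal 2)⁻¹ * 1
  -- The condition 0 ≤ h ≤ 1 almost everywhere is encoded by integrals over measurable sets, which
  -- makes it weak-* closed; `R` bounds the L² norm of such `h`.
  let C : Set (WeakDual ℝ (Lp ℝ 2 ν)) :=
    (WeakDual.toStrongDual ⁻¹' Metric.closedBall 0 R) ∩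
      ⋂ A, {φ | φ (ind A) ∈ Set.Icc 0 (ν.real A.1)}
  have hC : IsCompact C := (WeakDual.isCompact_closedBall 0 R).inter_right <|
    isClosed_iInter fun A => isClosed_Icc.preimage (WeakDual.eval_continuous (ind A))
  have hcont : Continuous fun (φ : WeakDual ℝ (Lp ℝ 2 ν)) m => φ (g m) :=
    continuous_pi fun m => WeakDual.eval_continuous (g m)
  have hval : ∀ (h : Lp ℝ 2 ν) m, inner ℝ h (g m) = ∫ x, h x ∂P m := by
    intro h m
    rw [L2.inner_def, ← integral_rnDeriv_smul (hac m)]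
    refine integral_congr_ae ?_
    filter_upwards [(hr2 m).coeFn_toLp] with x hx
    simp [g, hx, r]
  have hind : ∀ (h : Lp ℝ 2 ν) A, inner ℝ h (ind A) = ∫ x in A.1, h x ∂ν := by
    intro h A
    rw [real_inner_comm, L2.inner_indicatorConstLp_one]
  convert hC.image hcont using 1
  apply Set.Subset.antisymm
  · rintro v ⟨h, hh, hv⟩
    have hb : ∀ᵐ x ∂ν, ‖h x‖ ≤ 1 := ae_of_all _ fun x => by
      rw [Real.norm_eq_abs, abs_of_nonneg (hh.2 x).1]; exact (hh.2 x).2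
    have h2 : MemLp h 2 ν := MemLp.of_bound hh.1.aestronglyMeasurable 1 hb
    have hco := h2.coeFn_toLp
    refine ⟨StrongDual.toWeakDual (InnerProductSpace.toDual ℝ _ (h2.toLp h)), ⟨?_, ?_⟩, ?_⟩
    · have : ‖InnerProductSpace.toDual ℝ _ (h2.toLp h)‖ ≤ R := by
        rw [LinearIsometryEquiv.norm_map]
        refine Lp.norm_le_of_ae_bound zero_le_one ?_
        filter_upwards [hco, hb] with x hx hx'
        rwa [hx]
      simpa [Metric.mem_closedBall, dist_zero_right] using this
    · refine Set.mem_iInter.2 fun A => ?_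
      change inner ℝ (h2.toLp h) (ind A) ∈ Set.Icc 0 (ν.real A.1)
      rw [hind, setIntegral_congr_ae A.2 (g := h) (hco.mono fun x hx _ => hx)]
      refine ⟨integral_nonneg fun x => (hh.2 x).1, ?_⟩
      calc ∫ x in A.1, h x ∂ν ≤ ∫ x in A.1, (1 : ℝ) ∂ν :=
            integral_mono (hh.integrable _) (integrable_const _) fun x => (hh.2 x).2
        _ = ν.real A.1 := by simp
    · ext m
      change inner ℝ (h2.toLp h) (g m) = _
      rw [hval, hv]
      exact integral_congr_ae ((hac m).ae_le hco)
  · rintro _ ⟨φ, ⟨-, hφ⟩, rfl⟩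
    let h := (InnerProductSpace.toDual ℝ _).symm (WeakDual.toStrongDual φ)
    have hφh : ∀ y, φ y = inner ℝ h y := fun y =>
      (InnerProductSpace.toDual_symm_apply (x := y) (y := WeakDual.toStrongDual φ)).symm
    have hint : Integrable h ν := (Lp.memLp h).integrable (by norm_num)
    have hA : ∀ A, MeasurableSet A → ∫ x in A, h x ∂ν ∈ Set.Icc 0 (ν.real A) := fun A hA => by
      have := Set.mem_iInter.1 hφ ⟨A, hA⟩
      simpa only [Set.mem_ofPred_eq, hφh, hind] using this
    have h0 : 0 ≤ᵐ[ν] h := ae_nonneg_of_forall_setIntegral_nonneg hint fun A hm _ => (hA A hm).1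
    have h1 : 0 ≤ᵐ[ν] fun x => 1 - h x :=
      ae_nonneg_of_forall_setIntegral_nonneg ((integrable_const 1).sub hint) fun A hm _ => by
        rw [integral_sub (integrable_const 1) hint.integrableOn]
        simpa using (hA A hm).2
    -- The L² representative has values in [0,1] only almost everywhere; clamping makes it a test.
    refine ⟨fun x => max 0 (min 1 (h x)), ⟨?_, fun x => ?_⟩, fun m => ?_⟩
    · exact measurable_const.max (measurable_const.min (Lp.stronglyMeasurable h).measurable)
    · exact ⟨le_max_left _ _, max_le zero_le_one (min_le_left _ _)⟩
    · simp only [hφh, hval]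
      refine integral_congr_ae ((hac m).ae_le ?_)
      filter_upwards [h0, h1] with x hx0 hx1
      simp only [Pi.zero_apply, sub_nonneg] at hx0 hx1
      rw [min_eq_right hx1, max_eq_right hx0]

/-- A test attaining an extreme point of the region is almost surely an indicator. -/
theorem exists_indicator_of_mem_extremePoints (P : κ → Measure X) [∀ m, IsFiniteMeasure (P m)]
    {v : κ → ℝ} (hv : v ∈ (testRegion P).extremePoints ℝ) :
    ∃ A : Set X, MeasurableSet A ∧ ∀ m, v m = (P m).real A := by
  obtain ⟨⟨h, hh, hvh⟩, hext⟩ := mem_extremePoints_iff_left.1 hv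
  -- Both `h + g` and `h - g` are tests, with midpoint `h`; extremality gives `g` integral zero, so
  -- `h` is 0 or 1 almost surely.
  let g : X → ℝ := fun x => min (h x) (1 - h x)
  have hgm : Measurable g := hh.1.min (hh.1.const_sub 1)
  have hg0 : ∀ x, 0 ≤ g x := fun x => le_min (hh.2 x).1 (sub_nonneg.2 (hh.2 x).2)
  have hgt : IsTest g := ⟨hgm, fun x => ⟨hg0 x, (min_le_left _ _).trans (hh.2 x).2⟩⟩
  have hadd : (fun m => v m + ∫ x, g x ∂P m) ∈ testRegion P := by
    refine ⟨fun x => h x + g x, ⟨hh.1.add hgm, fun x => ⟨add_nonneg (hh.2 x).1 (hg0 x), ?_⟩⟩,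
      fun m => ?_⟩
    · linarith [min_le_right (h x) (1 - h x)]
    · rw [integral_add (hh.integrable _) (hgt.integrable _), ← hvh]
  have hsub : (fun m => v m - ∫ x, g x ∂P m) ∈ testRegion P := by
    refine ⟨fun x => h x - g x, ⟨hh.1.sub hgm, fun x => ⟨?_, ?_⟩⟩, fun m => ?_⟩
    · linarith [min_le_left (h x) (1 - h x)]
    · linarith [hg0 x, (hh.2 x).2]
    · rw [integral_sub (hh.integrable _) (hgt.integrable _), ← hvh]
  have heq := hext _ hadd _ hsub ⟨1 / 2, 1 / 2, by norm_num, by norm_num, by norm_num, by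
    ext m; simp; ring⟩
  refine ⟨{x | h x = 1}, hh.1 (measurableSet_singleton 1), fun m => ?_⟩
  have hz : ∫ x, g x ∂P m = 0 := by have := congrFun heq m; simpa using this
  have hae := (integral_eq_zero_iff_of_nonneg hg0 (hgt.integrable _)).1 hz
  rw [hvh]
  refine Eq.trans ?_ (integral_indicator_one (hh.1 (measurableSet_singleton 1)))
  refine integral_congr_ae ?_
  filter_upwards [hae] with x hx
  by_cases h1 : h x = 1
  · simp [h1]
  · have : h x = 0 := by
      rcases min_choice (h x) (1 - h x) with h' | h' <;> simp only [g, h', Pi.zero_apply] at hx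
      · exact hx
      · exact absurd (by linarith) h1
    simp [this]

end Region
-- Convexity and continuity of the binary divergence on the region.
section KL

open Filter Topology

/-- The summand `a log (a / b)` of a K-L divergence. -/
noncomputable def klTerm (a b : ℝ) : ℝ :=
  a * Real.log (a / b)

/-- The K-L divergence of a Bernoulli law with mean `a` from one with mean `b`. -/
noncomputable def binaryKL (a b : ℝ) : ℝ :=
  klTerm a b + klTerm (1 - a) (1 - b)

/-- This is log x ≥ 1 - 1/x at x = a/(bt). The left side is linear in (a, b) and touches `klTerm`
along a = tb, which yields both convexity and the data-processing bound. -/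
theorem tangent_le_klTerm {a b t : ℝ} (ha : 0 ≤ a) (hb : 0 ≤ b) (hab : b = 0 → a = 0)
    (ht : 0 < t) : a * Real.log t + a - t * b ≤ klTerm a b := by
  unfold klTerm
  rcases ha.eq_or_lt with rfl | ha
  · simp only [zero_mul, zero_add, zero_sub]
    have := mul_nonneg ht.le hb
    linarith
  · have hb : 0 < b := lt_of_le_of_ne hb fun h => ha.ne' (hab h.symm)
    have hx : 0 < a / b / t := by positivity
    have h1 := mul_le_mul_of_nonneg_left (Real.one_sub_inv_le_log_of_pos hx) ha.le
    rw [Real.log_div (by positivity) ht.ne'] at h1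
    have h2 : a * (1 - (a / b / t)⁻¹) = a - t * b := by field_simp
    linarith

/-- The log-sum inequality: both points are compared with the tangent whose slope is the ratio at
the combined point, where the tangent is exact. -/
theorem klTerm_convex_comb_le {a b a' b' s t : ℝ} (ha : 0 ≤ a) (hb : 0 ≤ b) (hab : b = 0 → a = 0)
    (ha' : 0 ≤ a') (hb' : 0 ≤ b') (hab' : b' = 0 → a' = 0) (hs : 0 ≤ s) (ht : 0 ≤ t) :
    klTerm (s * a + t * a') (s * b + t * b') ≤ s * klTerm a b + t * klTerm a' b' := by
  have hsa := mul_nonneg hs ha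
  have hta := mul_nonneg ht ha'
  have hsb := mul_nonneg hs hb
  have htb := mul_nonneg ht hb'
  rcases (add_nonneg hsa hta).eq_or_lt with h0 | hA
  · have h1 : s * a = 0 := by linarith
    have h2 : t * a' = 0 := by linarith
    simp only [klTerm, ← mul_assoc, h1, h2]
    simp
  · have hB : 0 < s * b + t * b' := by
      refine lt_of_le_of_ne (add_nonneg hsb htb) fun h => hA.ne' ?_
      have h1 : s * b = 0 := by linarith
      have h2 : t * b' = 0 := by linarith
      have h3 : s * a = 0 := by rcases mul_eq_zero.1 h1 with h | h <;> simp [h, hab]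
      have h4 : t * a' = 0 := by rcases mul_eq_zero.1 h2 with h | h <;> simp [h, hab']
      linarith
    have hτ := div_pos hA hB
    have h1 := mul_le_mul_of_nonneg_left (tangent_le_klTerm ha hb hab hτ) hs
    have h2 := mul_le_mul_of_nonneg_left (tangent_le_klTerm ha' hb' hab' hτ) ht
    have h3 : (s * a + t * a') / (s * b + t * b') * (s * b + t * b') = s * a + t * a' :=
      div_mul_cancel₀ _ hB.ne'
    set τ := (s * a + t * a') / (s * b + t * b')
    calc klTerm (s * a + t * a') (s * b + t * b') = (s * a + t * a') * Real.log τ := rfl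
      _ = s * (a * Real.log τ + a - τ * b) + t * (a' * Real.log τ + a' - τ * b') := by
        linear_combination h3
      _ ≤ _ := add_le_add h1 h2

variable {X κ : Type*} [MeasurableSpace X] {P : κ → Measure X} [∀ m, IsProbabilityMeasure (P m)]

theorem mem_Icc_of_mem_testRegion {v : κ → ℝ} (hv : v ∈ testRegion P) (m : κ) :
    v m ∈ Set.Icc (0 : ℝ) 1 := by
  obtain ⟨h, hh, hvh⟩ := hv
  rw [hvh]
  refine ⟨integral_nonneg fun x => (hh.2 x).1, ?_⟩
  calc ∫ x, h x ∂P m ≤ ∫ _, (1 : ℝ) ∂P m :=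
        integral_mono (hh.integrable _) (integrable_const _) fun x => (hh.2 x).2
    _ = 1 := by simp

theorem one_sub_mem_testRegion {v : κ → ℝ} (hv : v ∈ testRegion P) :
    (fun m => 1 - v m) ∈ testRegion P := by
  obtain ⟨h, hh, hvh⟩ := hv
  refine ⟨_, hh.one_sub, fun m => ?_⟩
  rw [integral_sub (integrable_const 1) (hh.integrable _), ← hvh]
  simp

theorem eq_zero_of_mem_testRegion {v : κ → ℝ} (hv : v ∈ testRegion P) {m m' : κ}
    (hac : P m ≪ P m') (h0 : v m' = 0) : v m = 0 := by
  obtain ⟨h, hh, hvh⟩ := hv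
  rw [hvh] at h0 ⊢
  have := (integral_eq_zero_iff_of_nonneg (fun x => (hh.2 x).1) (hh.integrable _)).1 h0
  rw [integral_congr_ae (hac.ae_le this)]
  simp

theorem convexOn_binaryKL {m m' : κ} (hac : P m ≪ P m') :
    ConvexOn ℝ (testRegion P) fun v => binaryKL (v m) (v m') := by
  refine ⟨convex_testRegion P, fun v hv v' hv' s t hs ht hst => ?_⟩
  have aux : ∀ {v v' : κ → ℝ}, v ∈ testRegion P → v' ∈ testRegion P →
      klTerm (s * v m + t * v' m) (s * v m' + t * v' m') ≤
        s * klTerm (v m) (v m') + t * klTerm (v' m) (v' m') := fun hv hv' =>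
    klTerm_convex_comb_le (mem_Icc_of_mem_testRegion hv _).1 (mem_Icc_of_mem_testRegion hv _).1
      (eq_zero_of_mem_testRegion hv hac) (mem_Icc_of_mem_testRegion hv' _).1
      (mem_Icc_of_mem_testRegion hv' _).1 (eq_zero_of_mem_testRegion hv' hac) hs ht
  have h1 := aux hv hv'
  have h2 := aux (one_sub_mem_testRegion hv) (one_sub_mem_testRegion hv')
  have e : ∀ a b : ℝ, s * (1 - a) + t * (1 - b) = 1 - (s * a + t * b) := fun a b => by
    linear_combination hst
  simp only [e] at h2
  simp only [binaryKL, Pi.add_apply, Pi.smul_apply, smul_eq_mul]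
  linarith

/-- The likelihood ratio times its logarithm, the integrand of the K-L divergence of `P` from
`Q` relative to `Q`. -/
noncomputable def klIntegrand (P Q : Measure X) (x : X) : ℝ :=
  klTerm (P.rnDeriv Q x).toReal 1

theorem integrable_klIntegrand {P Q : Measure X} [IsFiniteMeasure P] [IsFiniteMeasure Q]
    (hac : P ≪ Q) (hint : Integrable (llr P Q) P) : Integrable (klIntegrand P Q) Q :=
  ((integrable_rnDeriv_mul_log_iff hac).2 hint).congr <| ae_of_all _ fun x => by
    simp [klIntegrand, klTerm]

theorem integrable_truncation {Q : Measure X} [IsFiniteMeasure Q] {q : X → ℝ}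
    (hq : Integrable q Q) (K : ℝ) : Integrable (fun x => max (q x - K) 0) Q :=
  (hq.sub (integrable_const K)).pos_part

theorem tendsto_integral_truncation {Q : Measure X} [IsFiniteMeasure Q] {q : X → ℝ}
    (hq : Integrable q Q) :
    Tendsto (fun n : ℕ => ∫ x, max (q x - n) 0 ∂Q) atTop (𝓝 0) := by
  have := tendsto_integral_of_dominated_convergence (μ := Q)
    (F := fun (n : ℕ) x => max (q x - n) 0) (f := fun _ => 0) (fun x => |q x|)
    (fun n => (integrable_truncation hq n).aestronglyMeasurable) hq.abs
    (fun n => ae_of_all _ fun x => by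
      rw [Real.norm_eq_abs, abs_of_nonneg (le_max_right _ _)]
      refine max_le ?_ (abs_nonneg _)
      linarith [le_abs_self (q x), n.cast_nonneg (α := ℝ)])
    (ae_of_all _ fun x => by
      refine tendsto_const_nhds.congr' ?_
      obtain ⟨N, hN⟩ := exists_nat_ge (q x)
      filter_upwards [eventually_ge_atTop N] with n hn
      have : (N : ℝ) ≤ n := Nat.cast_le.2 hn
      rw [max_eq_right (by linarith)])
  simpa using this

/-- The data-processing bound with a truncated likelihood ratio. -/
theorem klTerm_le_of_mem_testRegion {v : κ → ℝ} (hv : v ∈ testRegion P) {m m' : κ}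
    (hac : P m ≪ P m') (hint : Integrable (llr (P m) (P m')) (P m)) {K : ℝ} (hK : 0 ≤ K) :
    klTerm (v m) (v m') ≤
      K * v m' + ∫ x, max (klIntegrand (P m) (P m') x - K) 0 ∂P m' := by
  have hb0 := (mem_Icc_of_mem_testRegion hv m').1
  rcases (mem_Icc_of_mem_testRegion hv m).1.eq_or_lt with ha | ha
  · rw [← ha]
    simp only [klTerm, zero_mul]
    exact add_nonneg (mul_nonneg hK hb0) (integral_nonneg fun x => le_max_right _ _)
  have hb : 0 < v m' := lt_of_le_of_ne hb0 fun h =>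
    ha.ne' (eq_zero_of_mem_testRegion hv hac h.symm)
  obtain ⟨h, hh, hvh⟩ := hv
  let r : X → ℝ := fun x => ((P m).rnDeriv (P m') x).toReal
  have hr : Integrable r (P m') := Measure.integrable_toReal_rnDeriv
  have hhr : ∫ x, h x * r x ∂P m' = v m := by
    rw [hvh, ← integral_rnDeriv_smul hac]
    exact integral_congr_ae (ae_of_all _ fun x => mul_comm _ _)
  have hir : Integrable (fun x => h x * r x) (P m') := hh.integrable_mul hr
  have hih : Integrable h (P m') := hh.integrable _
  set t := v m / v m'
  have htpos : 0 < t := div_pos ha hb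
  -- The tangent inequality at `(r x, 1)` is weighted by `h x`. With this choice of `t` the left
  -- side integrates to exactly `klTerm (v m) (v m')`.
  have hpt : ∀ x, (h x * r x) * (Real.log t + 1) - t * h x ≤
      K * h x + max (klIntegrand (P m) (P m') x - K) 0 := by
    intro x
    obtain ⟨h0, h1⟩ := hh.2 x
    have h2 : r x * Real.log t + r x - t * 1 ≤ klIntegrand (P m) (P m') x :=
      tangent_le_klTerm ENNReal.toReal_nonneg zero_le_one (by simp) htpos
    set q := klIntegrand (P m) (P m') x
    have h3 := mul_le_mul_of_nonneg_left h2 h0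
    have h4 : h x * (q - K) ≤ max (q - K) 0 :=
      (mul_le_mul_of_nonneg_left (le_max_left _ 0) h0).trans
        (mul_le_of_le_one_left (le_max_right _ _) h1)
    linarith
  have hmono := integral_mono ((hir.mul_const (Real.log t + 1)).sub (hih.const_mul t))
    ((hih.const_mul K).add (integrable_truncation (integrable_klIntegrand hac hint) K)) hpt
  rw [integral_sub' (hir.mul_const _) (hih.const_mul t), integral_mul_const, integral_const_mul,
    integral_add' (hih.const_mul K) (integrable_truncation (integrable_klIntegrand hac hint) K),
    integral_const_mul, hhr, ← hvh] at hmono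
  have : t * v m' = v m := div_mul_cancel₀ _ hb.ne'
  have h5 : klTerm (v m) (v m') = v m * Real.log t := rfl
  rw [h5]
  linarith

/-- The function a log(a/b) is not continuous at the origin of the quadrant; on the region, finite
divergence supplies the uniform integrability that restores continuity there. -/
theorem continuousOn_klTerm {m m' : κ} (hac : P m ≪ P m')
    (hint : Integrable (llr (P m) (P m')) (P m)) :
    ContinuousOn (fun v : κ → ℝ => klTerm (v m) (v m')) (testRegion P) := by
  intro v hv
  have hca : Continuous fun v : κ → ℝ => v m := continuous_apply m
  have hcb : Continuous fun v : κ → ℝ => v m' := continuous_apply m'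
  by_cases hb : v m' = 0
  · have ha := eq_zero_of_mem_testRegion hv hac hb
    rw [ContinuousWithinAt, ha, show klTerm 0 (v m') = 0 by simp [klTerm], Metric.tendsto_nhds]
    intro ε hε
    obtain ⟨N, hN⟩ := ((tendsto_integral_truncation
      (integrable_klIntegrand hac hint)).eventually_lt_const (half_pos hε)).exists
    -- The factor `N` serves the truncated upper bound; the extra 1 serves the lower bound `u m - u
    -- m'` from the tangent with t = 1.
    have hnear : ∀ᶠ u in 𝓝[testRegion P] v, (N + 1) * u m' < ε / 2 := by
      refine mem_nhdsWithin_of_mem_nhds (ContinuousAt.eventually_lt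
        (f := fun u : κ → ℝ => (N + 1) * u m') (continuous_const.mul hcb).continuousAt
        continuousAt_const ?_)
      simpa [hb] using half_pos hε
    filter_upwards [hnear, self_mem_nhdsWithin] with u hu huW
    have h1 := klTerm_le_of_mem_testRegion huW hac hint (Nat.cast_nonneg N)
    obtain ⟨ha0, -⟩ := mem_Icc_of_mem_testRegion huW m
    obtain ⟨hb0, -⟩ := mem_Icc_of_mem_testRegion huW m'
    have h2 := tangent_le_klTerm ha0 hb0 (eq_zero_of_mem_testRegion huW hac) one_pos
    have h3 := mul_nonneg (Nat.cast_nonneg (α := ℝ) N) hb0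
    rw [Real.log_one] at h2
    rw [Real.dist_eq, sub_zero, abs_lt]
    constructor <;> linarith
  -- Splitting the logarithm isolates a log a, which is continuous even at a = 0.
  · refine ContinuousAt.continuousWithinAt (ContinuousAt.congr
      (f := fun u : κ → ℝ => u m * Real.log (u m) - u m * Real.log (u m')) ?_ ?_)
    · exact (Real.continuous_mul_log.comp hca).continuousAt.sub
        (hca.continuousAt.mul (hcb.continuousAt.log hb))
    · filter_upwards [hcb.continuousAt.eventually_ne hb] with u hu
      by_cases ha : u m = 0
      · simp [klTerm, ha]
      · rw [klTerm, Real.log_div ha hu, mul_sub]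

theorem continuousOn_binaryKL {m m' : κ} (hac : P m ≪ P m')
    (hint : Integrable (llr (P m) (P m')) (P m)) :
    ContinuousOn (fun v : κ → ℝ => binaryKL (v m) (v m')) (testRegion P) :=
  (continuousOn_klTerm hac hint).add
    ((continuousOn_klTerm hac hint).comp (f := fun (v : κ → ℝ) m => 1 - v m)
      (by fun_prop) fun _ hv => one_sub_mem_testRegion hv)

end KL
-- Supporting functionals at extreme points.
section Support

open Filter Topology

theorem notMem_interior_of_mem_extremePoints {E : Type*} [NormedAddCommGroup E] [NormedSpace ℝ E]
    [Nontrivial E] {W : Set E} {v : E} (hv : v ∈ W.extremePoints ℝ) : v ∉ interior W := by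
  intro hint
  obtain ⟨e, he⟩ := exists_ne (0 : E)
  have hW := mem_interior_iff_mem_nhds.1 hint
  have h1 : ∀ᶠ t : ℝ in 𝓝 0, v + t • e ∈ W :=
    ContinuousAt.preimage_mem_nhds (f := fun t : ℝ => v + t • e) (by fun_prop) (by simpa using hW)
  have h2 : ∀ᶠ t : ℝ in 𝓝 0, v - t • e ∈ W :=
    ContinuousAt.preimage_mem_nhds (f := fun t : ℝ => v - t • e) (by fun_prop) (by simpa using hW)
  obtain ⟨t, ⟨ht1, ht2⟩, ht0⟩ := (((h1.and h2).filter_mono nhdsWithin_le_nhds).and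
    (self_mem_nhdsWithin (a := (0 : ℝ)) (s := Set.Ioi 0))).exists
  have := (mem_extremePoints_iff_left.1 hv).2 _ ht1 _ ht2
    ⟨1 / 2, 1 / 2, by norm_num, by norm_num, by norm_num, by
      rw [smul_add, smul_sub, add_add_sub_cancel, ← add_smul]; norm_num⟩
  rw [add_eq_left, smul_eq_zero] at this
  exact this.elim (ne_of_gt ht0) he

/-- In finite dimension a convex set has a nontrivial supporting functional at each of its points
outside the interior. -/
theorem exists_supporting_functional {E : Type*} [NormedAddCommGroup E] [NormedSpace ℝ E]
    [FiniteDimensional ℝ E] {W : Set E} (hW : Convex ℝ W) {v : E} (hvW : v ∈ W)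
    (hv : v ∉ interior W) : ∃ g : E →ₗ[ℝ] ℝ, g ≠ 0 ∧ ∀ w ∈ W, g w ≤ g v := by
  by_cases hne : (interior W).Nonempty
  · obtain ⟨g, hg⟩ := geometric_hahn_banach_open_point hW.interior isOpen_interior hv
    refine ⟨g, ?_, fun w hw => ?_⟩
    · rintro h0
      obtain ⟨w, hw⟩ := hne
      have h := hg w hw
      have h' : ∀ x, g x = 0 := fun x => LinearMap.congr_fun h0 x
      simp [h'] at h
    · have hmem : w ∈ closure (interior W) := by
        rw [hW.closure_interior_eq_closure_of_nonempty_interior hne]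
        exact subset_closure hw
      exact closure_minimal (fun x hx => (hg x hx).le)
        (isClosed_le g.continuous continuous_const) hmem
  -- With empty interior, `W` lies in a proper affine subspace, and some nonzero functional is
  -- constant on it.
  · have hspan : affineSpan ℝ W ≠ ⊤ := fun h =>
      hne (hW.interior_nonempty_iff_affineSpan_eq_top.2 h)
    have hvs : vectorSpan ℝ W < ⊤ := lt_top_iff_ne_top.2 fun h =>
      hspan ((AffineSubspace.affineSpan_eq_top_iff_vectorSpan_eq_top_of_nonempty ℝ E E
        ⟨v, hvW⟩).2 h)
    obtain ⟨g, hg0, hg⟩ := Submodule.exists_le_ker_of_lt_top _ hvs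
    refine ⟨g, hg0, fun w hw => ?_⟩
    have := hg (vsub_mem_vectorSpan ℝ hw hvW)
    rw [LinearMap.mem_ker, vsub_eq_sub, map_sub] at this
    linarith

end Support

/-! ### From extreme points to quantizers, and optimality. -/

section Densities

variable {X : Type*} [MeasurableSpace X] {M : ℕ} {μ : Measure X} {f : Fin M → X → ℝ}

theorem isProbabilityMeasure_law (hf_prob : ∀ m, ∫⁻ x, ENNReal.ofReal (f m x) ∂μ = 1)
    (m : Fin M) : IsProbabilityMeasure (law μ f m) :=
  ⟨by rw [law, withDensity_apply _ MeasurableSet.univ, setLIntegral_univ, hf_prob]⟩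

theorem integrable_density (hf_meas : ∀ m, Measurable (f m)) (hf_nonneg : ∀ m x, 0 ≤ f m x)
    (hf_prob : ∀ m, ∫⁻ x, ENNReal.ofReal (f m x) ∂μ = 1) (m : Fin M) : Integrable (f m) μ := by
  refine ⟨(hf_meas m).aestronglyMeasurable, ?_⟩
  rw [hasFiniteIntegral_iff_ofReal (ae_of_all _ (hf_nonneg m)), hf_prob]
  exact ENNReal.one_lt_top

theorem integral_law (hf_meas : ∀ m, Measurable (f m)) (hf_nonneg : ∀ m x, 0 ≤ f m x)
    (m : Fin M) (h : X → ℝ) : ∫ x, h x ∂law μ f m = ∫ x, h x * f m x ∂μ := by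
  rw [law, integral_withDensity_eq_integral_toReal_smul (hf_meas m).ennreal_ofReal
    (ae_of_all _ fun _ => ENNReal.ofReal_lt_top)]
  exact integral_congr_ae (ae_of_all _ fun x => by
    simp [ENNReal.toReal_ofReal (hf_nonneg m x), mul_comm])

/-- A linear functional of the test expectations is the integral of the test against the linear
combination of the densities. -/
theorem sum_mul_integral_law (hf_meas : ∀ m, Measurable (f m)) (hf_nonneg : ∀ m x, 0 ≤ f m x)
    (hf_prob : ∀ m, ∫⁻ x, ENNReal.ofReal (f m x) ∂μ = 1) (a : Fin M → ℝ) {h : X → ℝ}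
    (hh : IsTest h) :
    ∑ m, a m * ∫ x, h x ∂law μ f m = ∫ x, h x * ∑ m, a m * f m x ∂μ := by
  simp_rw [integral_law hf_meas hf_nonneg, Finset.mul_sum, ← integral_const_mul]
  rw [integral_finsetSum]
  · exact Finset.sum_congr rfl fun m _ => integral_congr_ae (ae_of_all _ fun x => by ring)
  · exact fun m _ => hh.integrable_mul ((integrable_density hf_meas hf_nonneg hf_prob m).const_mul _)

theorem msgProb_one_eq_integral (m : Fin M) (φ : Det X) :
    msgProb μ f m φ 1 = ∫ x, {x | φ.1 x = 1}.indicator (fun _ => (1 : ℝ)) x ∂law μ f m :=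
  (integral_indicator_one (φ.2 (measurableSet_singleton 1))).symm

theorem msgProb_one_mem_testRegion (φ : Det X) :
    (fun m => msgProb μ f m φ 1) ∈ testRegion (law μ f) :=
  ⟨_, isTest_indicator (φ.2 (measurableSet_singleton 1)), fun m => msgProb_one_eq_integral m φ⟩

theorem detInfo_eq_binaryKL (hf_prob : ∀ m, ∫⁻ x, ENNReal.ofReal (f m x) ∂μ = 1)
    (m m' : Fin M) (φ : Det X) :
    detInfo μ f m m' φ = binaryKL (msgProb μ f m φ 1) (msgProb μ f m' φ 1) := by
  have hP := isProbabilityMeasure_law hf_prob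
  have h0 : ∀ k, msgProb μ f k φ 0 = 1 - msgProb μ f k φ 1 := fun k => by
    have hc : {x | φ.1 x = 0} = {x | φ.1 x = 1}ᶜ := by
      ext x; simp only [Set.mem_ofPred_eq, Set.mem_compl_iff]; omega
    rw [msgProb, hc]
    exact probReal_compl_eq_one_sub (φ.2 (measurableSet_singleton 1))
  rw [detInfo, Fin.sum_univ_two, h0, h0, add_comm]
  rfl

theorem exists_det_of_mem_extremePoints (hf_prob : ∀ m, ∫⁻ x, ENNReal.ofReal (f m x) ∂μ = 1)
    {v : Fin M → ℝ} (hv : v ∈ (testRegion (law μ f)).extremePoints ℝ) :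
    ∃ φ : Det X, ∀ m, msgProb μ f m φ 1 = v m := by
  classical
  have hP := isProbabilityMeasure_law hf_prob
  obtain ⟨A, hA, hvA⟩ := exists_indicator_of_mem_extremePoints _ hv
  refine ⟨⟨fun x => if x ∈ A then 1 else 0, Measurable.ite hA measurable_const measurable_const⟩,
    fun m => ?_⟩
  rw [hvA, msgProb]
  congr 1
  ext x
  by_cases h : x ∈ A <;> simp [h]

/-- For linearly independent densities the extreme points of the region of test expectations come
from unambiguous likelihood quantizers. -/
theorem exists_isULQ_of_mem_extremePoints (hM : 0 < M) (hf_meas : ∀ m, Measurable (f m))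
    (hf_nonneg : ∀ m x, 0 ≤ f m x) (hf_prob : ∀ m, ∫⁻ x, ENNReal.ofReal (f m x) ∂μ = 1)
    (hind : DensLinIndep μ f) {v : Fin M → ℝ}
    (hv : v ∈ (testRegion (law μ f)).extremePoints ℝ) :
    ∃ φ : Det X, IsULQ μ f φ ∧ ∀ m, msgProb μ f m φ 1 = v m := by
  classical
  have hP := isProbabilityMeasure_law hf_prob
  have : Nonempty (Fin M) := ⟨⟨0, hM⟩⟩
  obtain ⟨g, hg0, hg⟩ := exists_supporting_functional (convex_testRegion (law μ f)) hv.1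
    (notMem_interior_of_mem_extremePoints hv)
  let a : Fin M → ℝ := fun m => g (Pi.single m 1)
  have hga : ∀ w, g w = ∑ m, a m * w m := fun w => by
    conv_lhs => rw [pi_eq_sum_univ' w]
    simp [a, mul_comm]
  have ha : a ≠ 0 := fun h => hg0 <| LinearMap.ext fun w => by simp [hga, h]
  have htie := hind a ha
  let s : X → ℝ := fun x => ∑ m, a m * f m x
  have hs : Measurable s := Finset.measurable_sum _ fun m _ => (hf_meas m).const_mul _
  have hsi : Integrable s μ := integrable_finsetSum _ fun m _ =>
    (integrable_density hf_meas hf_nonneg hf_prob m).const_mul _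
  have hsm : MeasurableSet {x | 0 < s x} := measurableSet_lt measurable_const hs
  let φ : Det X := ⟨fun x => if 0 < s x then 1 else 0,
    Measurable.ite hsm measurable_const measurable_const⟩
  refine ⟨φ, ⟨a, fun x => rfl, htie⟩, fun m => ?_⟩
  obtain ⟨h, hh, hvh⟩ := hv.1
  let k : X → ℝ := {x | φ.1 x = 1}.indicator fun _ => 1
  have hk : IsTest k := isTest_indicator (φ.2 (measurableSet_singleton 1))
  have hkpos : ∀ x, 0 < s x → k x = 1 := fun x hx => by simp [k, φ, hx]
  have hkneg : ∀ x, ¬0 < s x → k x = 0 := fun x hx => by simp [k, φ, hx]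
  -- Neyman–Pearson: `h` maximizes the integral of h·s because `v` is a support point, while `k`
  -- maximizes h·s pointwise. Hence `h` and `k` agree wherever `s ≠ 0`, which is almost surely by
  -- `htie`.
  have hle := hg _ (msgProb_one_mem_testRegion φ)
  simp only [hga, msgProb_one_eq_integral, hvh] at hle
  rw [sum_mul_integral_law hf_meas hf_nonneg hf_prob a hk,
    sum_mul_integral_law hf_meas hf_nonneg hf_prob a hh] at hle
  have hnn : ∀ x, 0 ≤ k x * s x - h x * s x := fun x => by
    obtain ⟨h0, h1⟩ := hh.2 x
    rw [← sub_mul]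
    by_cases hx : 0 < s x
    · rw [hkpos x hx]
      exact mul_nonneg (by linarith) hx.le
    · rw [hkneg x hx]
      exact mul_nonneg_of_nonpos_of_nonpos (by linarith) (not_lt.1 hx)
  have hzero : ∫ x, (k x * s x - h x * s x) ∂μ = 0 := by
    refine le_antisymm ?_ (integral_nonneg hnn)
    rw [integral_sub (hk.integrable_mul hsi) (hh.integrable_mul hsi)]
    exact sub_nonpos.2 hle
  have hae := (integral_eq_zero_iff_of_nonneg hnn
    ((hk.integrable_mul hsi).sub (hh.integrable_mul hsi))).1 hzero
  rw [msgProb_one_eq_integral, hvh]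
  refine integral_congr_ae ?_
  have hne : ∀ᵐ x ∂law μ f m, s x ≠ 0 := by simpa [ae_iff] using htie m
  filter_upwards [(withDensity_absolutelyContinuous μ _).ae_le hae, hne] with x hx hsx
  rw [← sub_mul] at hx
  exact sub_eq_zero.1 ((mul_eq_zero.1 hx).resolve_right hsx)

/-- The divergence of a randomization of finitely many deterministic quantizers. -/
theorem randInfo_map {n : ℕ} (q : PMF (Fin n)) (φ : Fin n → Det X) (m m' : Fin M) :
    randInfo μ f m m' (q.map φ) = ∑ j, (q j).toReal * detInfo μ f m m' (φ j) := by
  classical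
  have hterm : ∀ ψ : Det X, ((q.map φ) ψ).toReal * detInfo μ f m m' ψ =
      ∑ j, if ψ = φ j then (q j).toReal * detInfo μ f m m' (φ j) else 0 := fun ψ => by
    rw [PMF.map_apply, tsum_fintype, ENNReal.toReal_sum fun j _ => by
      split_ifs <;> simp [PMF.apply_ne_top], Finset.sum_mul]
    refine Finset.sum_congr rfl fun j _ => ?_
    split_ifs with h <;> simp [h]
  simp only [randInfo, hterm]
  exact (hasSum_sum fun j _ => hasSum_ite_eq (φ j) _).tsum_eq

/-- A maximin quantizer can be chosen as a randomization of at most `M - 1` deterministic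
quantizers from any class that realizes the extreme points of the region of test expectations. -/
theorem exists_isMaximin_of_extremePoints (hM : 2 ≤ M)
    (hf_prob : ∀ m, ∫⁻ x, ENNReal.ofReal (f m x) ∂μ = 1) (hKL : KLAssumption μ f)
    {C : Det X → Prop} (hC : ∀ v ∈ (testRegion (law μ f)).extremePoints ℝ,
      ∃ φ, C φ ∧ ∀ m, msgProb μ f m φ 1 = v m) (m : Fin M) :
    ∃ φ : Rand X, IsMaximin μ f m φ ∧ RandomizesAtMost φ (M - 1) ∧ ∀ ψ ∈ φ.support, C ψ := by
  classical
  have hP := isProbabilityMeasure_law hf_prob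
  have hkl : ∀ i : {m' : Fin M // m' ≠ m}, law μ f m ≪ law μ f i ∧
      Integrable (llr (law μ f m) (law μ f i)) (law μ f m) := fun i =>
    InformationTheory.klDiv_ne_top_iff.1 (hKL m i i.2.symm).2.ne
  have hcard : Fintype.card {m' : Fin M // m' ≠ m} = M - 1 := by
    simp [Fintype.card_subtype_compl]
  have hne : Nonempty {m' : Fin M // m' ≠ m} := by
    rw [← Fintype.card_pos_iff, hcard]; omega
  let I : (Fin M → ℝ) → {m' : Fin M // m' ≠ m} → ℝ := fun v i => binaryKL (v m) (v i)
  have hI : ∀ (φ : Det X) (i : {m' : Fin M // m' ≠ m}),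
      detInfo μ f m i φ = I (fun k => msgProb μ f k φ 1) i := fun φ i =>
    detInfo_eq_binaryKL hf_prob m i φ
  have hcont : ContinuousOn I (testRegion (law μ f)) := continuousOn_pi.2 fun i =>
    continuousOn_binaryKL (hkl i).1 (hkl i).2
  have hcomp := isCompact_testRegion (law μ f)
  obtain ⟨c, β, n, w, v, hβ0, hβ1, hβ, hn, hw, hw1, hv, hc⟩ :=
    exists_maximin_mixture_extremePoints hcomp ⟨0, zero_mem_testRegion _⟩ hcont
      fun i => convexOn_binaryKL (hkl i).1
  choose φ hφC hφ using fun j => hC (v j) (hv j)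
  let q : PMF (Fin n) := PMF.ofFintype (fun j => ENNReal.ofReal (w j)) (by
    rw [← ENNReal.ofReal_sum_of_nonneg fun j _ => (hw j).le, hw1, ENNReal.ofReal_one])
  have hq : ∀ j, (q j).toReal = w j := fun j => by
    simp [q, ENNReal.toReal_ofReal (hw j).le]
  have hsupp : (q.map φ).support ⊆ Set.range φ := by
    rw [PMF.support_map]; exact Set.image_subset_range _ _
  have hlow : c ≤ minInfo μ f m (q.map φ) := le_ciInf fun i => by
    rw [randInfo_map]
    refine (hc i).trans (le_of_eq (Finset.sum_congr rfl fun j _ => ?_))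
    rw [hq, hI, funext (hφ j)]
  refine ⟨q.map φ, fun ψ => le_trans ?_ hlow, ?_, fun ψ hψ => ?_⟩
  -- Bounded payoffs make the series of any randomization summable, so the bound on β-averages
  -- passes to it; the minimum is at most the β-average.
  · obtain ⟨B, hB⟩ := hcomp.exists_bound_of_continuousOn hcont
    have hp : HasSum (fun φ => (ψ φ).toReal) 1 := by
      have h1 := ENNReal.hasSum_toReal (f := fun φ => ψ φ) (by simp [PMF.tsum_coe])
      rwa [← ENNReal.tsum_toReal_eq fun φ => ψ.apply_ne_top φ, ψ.tsum_coe,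
        ENNReal.toReal_one] at h1
    have hsum : ∀ i : {m' : Fin M // m' ≠ m},
        HasSum (fun φ => (ψ φ).toReal * detInfo μ f m i φ) (randInfo μ f m i ψ) := fun i => by
      refine (Summable.of_norm_bounded (hp.summable.mul_right B) fun φ => ?_).hasSum
      rw [norm_mul, Real.norm_of_nonneg ENNReal.toReal_nonneg, hI]
      exact mul_le_mul_of_nonneg_left
        ((norm_le_pi_norm _ i).trans (hB _ (msgProb_one_mem_testRegion φ))) ENNReal.toReal_nonneg
    have htot := hasSum_sum (s := Finset.univ) fun i _ => (hsum i).mul_left (β i)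
    have hle : ∑ i, β i * randInfo μ f m i ψ ≤ c := by
      refine hasSum_le (fun φ => ?_) htot (by simpa using hp.mul_right c)
      have h1 := mul_le_mul_of_nonneg_left (hβ _ (msgProb_one_mem_testRegion φ))
        (ENNReal.toReal_nonneg (a := ψ φ))
      rw [Finset.mul_sum] at h1
      refine (le_of_eq (Finset.sum_congr rfl fun i _ => ?_)).trans h1
      rw [hI]; ring
    calc minInfo μ f m ψ = ∑ i, β i * minInfo μ f m ψ := by rw [← Finset.sum_mul, hβ1, one_mul]
      _ ≤ ∑ i, β i * randInfo μ f m i ψ := Finset.sum_le_sum fun i _ =>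
          mul_le_mul_of_nonneg_left (ciInf_le (Set.finite_range _).bddBelow i) (hβ0 i)
      _ ≤ c := hle
  · calc (q.map φ).support.encard ≤ (Set.range φ).encard := Set.encard_le_encard hsupp
      _ ≤ (Set.univ : Set (Fin n)).encard := by
          rw [← Set.image_univ]; exact Set.encard_image_le _ _
      _ = (n : ℕ∞) := by simp [Set.encard_univ]
      _ ≤ ((M - 1 : ℕ) : ℕ∞) := by rw [hcard] at hn; exact_mod_cast hn
  · obtain ⟨j, rfl⟩ := hsupp hψ
    exact hφC j

end Densities
end Quantizer

theorem theorem4p3 {X : Type*} [MeasurableSpace X] (μ : Measure X) {M : ℕ} (hM : 2 ≤ M)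
    (f : Fin M → X → ℝ) (hf_meas : ∀ m, Measurable (f m)) (hf_nonneg : ∀ m x, 0 ≤ f m x)
    (hf_prob : ∀ m, ∫⁻ x, ENNReal.ofReal (f m x) ∂μ = 1)
    (hKL : Quantizer.KLAssumption μ f) :
    (∀ m : Fin M, ∃ φ : Quantizer.Rand X,
      Quantizer.IsMaximin μ f m φ ∧ Quantizer.RandomizesAtMost φ (M - 1)) ∧
    (Quantizer.DensLinIndep μ f → ∀ m : Fin M, ∃ φ : Quantizer.Rand X,
      Quantizer.IsMaximin μ f m φ ∧ Quantizer.RandomizesAtMost φ (M - 1) ∧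
        ∀ ψ ∈ φ.support, Quantizer.IsULQ μ f ψ) := by
  refine ⟨fun m => ?_, fun hind m => ?_⟩
  · obtain ⟨φ, h1, h2, -⟩ := Quantizer.exists_isMaximin_of_extremePoints hM hf_prob hKL
      (C := fun _ => True) (fun v hv => by
        obtain ⟨φ, hφ⟩ := Quantizer.exists_det_of_mem_extremePoints hf_prob hv
        exact ⟨φ, trivial, hφ⟩) m
    exact ⟨φ, h1, h2⟩
  · exact Quantizer.exists_isMaximin_of_extremePoints hM hf_prob hKL
      (fun v hv => Quantizer.exists_isULQ_of_mem_extremePoints (by omega) hf_meas hf_nonneg hf_prob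
        hind hv) m
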